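/- Let $d\in\mathbb N$ and $p\in[1,\infty)$, and equip $\mathbb R^d$ with the Euclidean norm $\|\cdot\|$. Let $\mathcal P_p(\mathbb R^d)$ be the set of Borel probability measures $P$ on $\mathbb R^d$ with $\int\|x\|^p\,P(dx)<\infty$. For $P,Q\in\mathcal P_p(\mathbb R^d)$ let $\mathrm{Cpl}(P,Q)$ be the set of Borel measures $\pi$ on $\mathbb R^d\times\mathbb R^d$ with first marginal $P$ and second marginal $Q$, let $(X,Y)$ denote the pair of coordinate projections on $\mathbb R^d\times\mathbb R^d$, and set $$\mathcal W_p(P,Q)=\Big(\inf_{\pi\in\mathrm{Cpl}(P,Q)}\mathbb E_\pi\big[\|X-Y\|^p\big]\Big)^{1/p},\qquad V_p(P,Q)=\Big(\inf_{\pi\in\mathrm{Cpl}(P,Q)}\mathbb E_\pi\Big[\big\|\mathbb E_\pi[X-Y\mid X]\big\|^p\Big]\Big)^{1/p},$$ $$\mathcal V_p(P,Q)=\max\{V_p(P,Q),V_p(Q,P)\}.$$ The $p$-Wasserstein topology on $\mathcal P_p(\mathbb R^d)$ is the topology induced by $\mathcal W_p$: a set $U$ is open if and only if for every $P\in U$ there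 is $\varepsilon>0$ such that every $Q\in\mathcal P_p(\mathbb R^d)$ with $\mathcal W_p(P,Q)<\varepsilon$ lies in $U$. Then $\mathcal V_p$ is a (finite-valued) metric on $\mathcal P_p(\mathbb R^d)$, and the topology that it induces is the $p$-Wasserstein topology. -/

import Mathlib

open scoped ENNReal MeasureTheory
open MeasureTheory

noncomputable section

namespace WeakTransport

/-- The Euclidean space `ℝ^d`. -/
abbrev E (d : ℕ) : Type := EuclideanSpace ℝ (Fin d)

/-- `P_p(ℝ^d)`: the Borel probability measures on `ℝ^d` with finite `p`-th moment. It is a plain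
type: no topology is put on it, in particular not the trace of the weak topology. -/
def PSpace (d : ℕ) (p : ℝ) : Type :=
  {μ : ProbabilityMeasure (E d) // ∫⁻ x, ‖x‖ₑ ^ p ∂(μ : Measure (E d)) < ∞}

/-- The measure underlying an element of `P_p(ℝ^d)`. -/
def PSpace.toMeasure {d : ℕ} {p : ℝ} (P : PSpace d p) : Measure (E d) :=
  (P.1 : Measure (E d))

/-- The couplings of `μ` and `ν`: measures on `ℝ^d × ℝ^d` with marginals `μ` and `ν`. -/
def Cpl {d : ℕ} (μ ν : Measure (E d)) : Set (Measure (E d × E d)) :=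
  {π | π.map Prod.fst = μ ∧ π.map Prod.snd = ν}

/-- The `p`-Wasserstein distance, `W_p(P,Q)^p = inf_π E_π ‖X - Y‖^p`. -/
def wasserstein {d : ℕ} {p : ℝ} (P Q : PSpace d p) : ℝ≥0∞ :=
  (⨅ π ∈ Cpl P.toMeasure Q.toMeasure, ∫⁻ z, ‖z.1 - z.2‖ₑ ^ p ∂π) ^ (1 / p)

/-- The `p`-Wasserstein topology: `U` is open iff it contains, with each of its points `P`, a
ball `{Q | W_p(P,Q) < ε}` with `ε > 0`. -/
def wassersteinTopology (d : ℕ) (p : ℝ) : TopologicalSpace (PSpace d p) where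
  IsOpen U := ∀ P ∈ U, ∃ ε : ℝ≥0∞, 0 < ε ∧ ∀ Q, wasserstein P Q < ε → Q ∈ U
  isOpen_univ := fun _ _ => ⟨1, one_pos, fun _ _ => Set.mem_univ _⟩
  isOpen_inter := by
    intro U V hU hV P hP
    obtain ⟨a, ha, hUa⟩ := hU P hP.1
    obtain ⟨b, hb, hVb⟩ := hV P hP.2
    exact ⟨min a b, lt_min ha hb, fun Q hQ =>
      ⟨hUa Q (hQ.trans_le (min_le_left _ _)), hVb Q (hQ.trans_le (min_le_right _ _))⟩⟩
  isOpen_sUnion := by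
    intro S hS P hP
    obtain ⟨U, hU, hPU⟩ := hP
    obtain ⟨a, ha, hUa⟩ := hS U hU P hPU
    exact ⟨a, ha, fun Q hQ => ⟨U, hU, hUa Q hQ⟩⟩

/-- The conditional expectation `E_π[X - Y | X]`, as a function on `ℝ^d × ℝ^d`, where `X` and `Y`
are the two coordinate projections. -/
def condDiff {d : ℕ} (π : Measure (E d × E d)) : E d × E d → E d :=
  π[fun z => z.1 - z.2 | MeasurableSpace.comap Prod.fst inferInstance]

/-- The weak transport quantity, `V_p(P,Q)^p = inf_π E_π ‖E_π[X - Y | X]‖^p`. -/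
def weakV {d : ℕ} {p : ℝ} (P Q : PSpace d p) : ℝ≥0∞ :=
  (⨅ π ∈ Cpl P.toMeasure Q.toMeasure, ∫⁻ z, ‖condDiff π z‖ₑ ^ p ∂π) ^ (1 / p)

/-- The symmetrization `max {V_p(P,Q), V_p(Q,P)}`. -/
def symV {d : ℕ} {p : ℝ} (P Q : PSpace d p) : ℝ≥0∞ :=
  max (weakV P Q) (weakV Q P)

end WeakTransport

end

/-!
A coupling of `P` and `Q` is `P ⊗ κ` for a Markov kernel `κ` carrying `P` to `Q`, and under it
`E[X - Y | X]` is the drift `x ↦ ∫ (x - y) κ(x, dy)`. The weak transport quantity is thus an infimum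
of `L^p` norms of drifts. The drift of a composed kernel is the first drift plus the average of the
second one, so Minkowski and Jensen give the triangle inequality (`weakV_triangle`); Jensen alone
gives `V_p ≤ W_p` (`weakV_le_wasserstein`), and finiteness comes from the independent coupling
(`weakV_lt_top`).

It remains to see that, for a fixed `P`, the Wasserstein distance `W_p(P, Q)` is small once both
`V_p(P, Q)` and `V_p(Q, P)` are (`exists_symV_lt_imp_wasserstein_lt`); this also yields the
separation of points. Take a kernel `κ` from `P` to `Q` of small drift, with `(X, Y)` of law
`P ⊗ κ`, and the strictly convex `1`-Lipschitz function `φ(x) = √(1 + ‖x‖²)`, with Bregman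
divergence `D(x, y) = φ(y) - φ(x) - ⟨∇φ(x), y - x⟩ ≥ 0`. Conditioning on `X` gives
`E D(X, Y) ≤ ∫ φ dQ - ∫ φ dP + V_p(P, Q)`, up to an arbitrarily small error, and the same
inequality for a kernel from `Q` to `P` bounds `∫ φ dQ - ∫ φ dP` by `V_p(Q, P)`
(`integral_bregman_le`). The kernel from `Q` to `P` also shows that the `L^p` norm of `Q` exceeds
that of `P` by at most `V_p(Q, P)` (`eLpNorm'_id_le`). Finally, for every `R` and `η > 0` there is
a constant `C` with
`‖x - y‖^p ≤ 2^(p-1) (‖y‖^p - ‖x‖^p) + 2^p ‖x‖^p 1_{‖x‖ > R} + η + C D(x, y)`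
(`norm_sub_rpow_le`). Taking expectations, and choosing first `R` and `η` and then the bound on the
drifts, makes `E ‖X - Y‖^p` small: the very coupling that is nearly optimal for `V_p(P, Q)` is a
good one for `W_p(P, Q)`.
-/

open ProbabilityTheory Filter Topology

namespace WeakTransport

variable {d : ℕ} {p : ℝ}

/-! ### Transport by kernels -/

instance (P : PSpace d p) : IsProbabilityMeasure P.toMeasure :=
  inferInstanceAs (IsProbabilityMeasure (P.1 : Measure (E d)))

/-- The mean displacement `x ↦ ∫ (x - y) κ(x, dy)` of a kernel `κ`. -/
noncomputable def drift (κ : Kernel (E d) (E d)) (x : E d) : E d := ∫ y, (x - y) ∂κ x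

lemma stronglyMeasurable_drift (κ : Kernel (E d) (E d)) [IsSFiniteKernel κ] :
    StronglyMeasurable (drift κ) :=
  StronglyMeasurable.integral_kernel_prod_right' (f := fun z : E d × E d => z.1 - z.2)
    (by fun_prop : Measurable fun z : E d × E d => z.1 - z.2).stronglyMeasurable

lemma PSpace.lintegral_lt_top (P : PSpace d p) : ∫⁻ x, ‖x‖ₑ ^ p ∂P.toMeasure < ∞ := P.2

lemma PSpace.eLpNorm_id_lt_top (hp : 1 ≤ p) (P : PSpace d p) :
    eLpNorm' (fun x => x) p P.toMeasure < ∞ :=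
  ENNReal.rpow_lt_top_of_nonneg (by positivity) P.lintegral_lt_top.ne

lemma PSpace.integrable_id (hp : 1 ≤ p) (P : PSpace d p) :
    Integrable (fun x : E d => x) P.toMeasure := by
  have hm : AEStronglyMeasurable (fun x : E d => x) P.toMeasure := by fun_prop
  refine ⟨hm, ?_⟩
  have h := (eLpNorm'_le_eLpNorm'_of_exponent_le one_pos hp _ hm).trans_lt (P.eLpNorm_id_lt_top hp)
  simpa [HasFiniteIntegral, eLpNorm'] using h

lemma PSpace.integrable_norm_rpow (hp : 1 ≤ p) (P : PSpace d p) :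
    Integrable (fun x : E d => ‖x‖ ^ p) P.toMeasure := by
  refine ⟨(measurable_norm.pow_const p).aestronglyMeasurable, ?_⟩
  have h := P.lintegral_lt_top
  refine lt_of_eq_of_lt (lintegral_congr fun x => ?_) h
  rw [Real.enorm_rpow_of_nonneg (norm_nonneg x) (by positivity), enorm_norm]

/-- Jensen's inequality for the `p`-th power of the norm of a vector-valued integral. -/
lemma enorm_integral_rpow_le {α F : Type*} {m : MeasurableSpace α} [NormedAddCommGroup F]
    [NormedSpace ℝ F] (hp : 1 ≤ p) (μ : Measure α) [IsProbabilityMeasure μ] {f : α → F}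
    (hf : AEStronglyMeasurable f μ) : ‖∫ x, f x ∂μ‖ₑ ^ p ≤ ∫⁻ x, ‖f x‖ₑ ^ p ∂μ := by
  have h := eLpNorm'_le_eLpNorm'_of_exponent_le one_pos hp μ hf
  simp only [eLpNorm', ENNReal.rpow_one, div_one] at h
  calc ‖∫ x, f x ∂μ‖ₑ ^ p ≤ ((∫⁻ x, ‖f x‖ₑ ^ p ∂μ) ^ (1 / p)) ^ p :=
        ENNReal.rpow_le_rpow ((enorm_integral_le_lintegral_enorm _).trans h) (by positivity)
    _ = _ := by rw [← ENNReal.rpow_mul, one_div_mul_cancel (by positivity), ENNReal.rpow_one]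

/-- Averaging a function against a Markov kernel does not increase its `L^p` norm. -/
lemma eLpNorm'_integral_kernel_le (hp : 1 ≤ p) (μ : Measure (E d))
    (κ : Kernel (E d) (E d)) [IsMarkovKernel κ] {f : E d → E d} (hf : StronglyMeasurable f) :
    eLpNorm' (fun x => ∫ y, f y ∂κ x) p μ ≤ eLpNorm' f p (κ ∘ₘ μ) := by
  refine ENNReal.rpow_le_rpow ?_ (by positivity)
  rw [Measure.lintegral_bind κ.aemeasurable (hf.enorm.pow_const p).aemeasurable]
  exact lintegral_mono fun x => enorm_integral_rpow_le hp _ hf.aestronglyMeasurable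

lemma mem_Cpl_compProd {P Q : Measure (E d)} [IsProbabilityMeasure P] {κ : Kernel (E d) (E d)}
    [IsMarkovKernel κ] (h : κ ∘ₘ P = Q) : P ⊗ₘ κ ∈ Cpl P Q :=
  ⟨Measure.fst_compProd P κ, by rw [← Measure.snd, Measure.snd_compProd, h]⟩

lemma exists_kernel_of_mem_Cpl {P Q : Measure (E d)} [IsProbabilityMeasure P]
    {π : Measure (E d × E d)} (h : π ∈ Cpl P Q) :
    ∃ κ : Kernel (E d) (E d), IsMarkovKernel κ ∧ κ ∘ₘ P = Q ∧ P ⊗ₘ κ = π := by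
  have : IsProbabilityMeasure (π.map Prod.fst) := by rw [h.1]; infer_instance
  have : IsProbabilityMeasure π := Measure.isProbabilityMeasure_of_map Prod.fst
  have h1 : π.fst = P := h.1
  have h2 : P ⊗ₘ π.condKernel = π := by rw [← h1]; exact π.disintegrate π.condKernel
  refine ⟨π.condKernel, inferInstance, ?_, h2⟩
  rw [← Measure.snd_compProd, h2]
  exact h.2

lemma integrable_sub_compProd {P Q : Measure (E d)} [IsProbabilityMeasure P]
    {κ : Kernel (E d) (E d)} [IsMarkovKernel κ] (h : κ ∘ₘ P = Q)
    (hP : Integrable (fun x : E d => x) P) (hQ : Integrable (fun x : E d => x) Q) :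
    Integrable (fun z : E d × E d => z.1 - z.2) (P ⊗ₘ κ) := by
  obtain ⟨h1, h2⟩ := mem_Cpl_compProd h
  refine Integrable.sub ?_ ?_
  · exact (h1 ▸ hP).comp_measurable measurable_fst
  · exact (h2 ▸ hQ).comp_measurable measurable_snd

/-- The conditional expectation `E[X - Y | X]` under `P ⊗ κ` is the mean displacement of `κ`. -/
lemma condDiff_compProd {P Q : Measure (E d)} [IsProbabilityMeasure P]
    {κ : Kernel (E d) (E d)} [IsMarkovKernel κ] (h : κ ∘ₘ P = Q)
    (hP : Integrable (fun x : E d => x) P) (hQ : Integrable (fun x : E d => x) Q) :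
    condDiff (P ⊗ₘ κ) =ᵐ[P ⊗ₘ κ] fun z => drift κ z.1 := by
  have hfst : (P ⊗ₘ κ).map Prod.fst = P := Measure.fst_compProd P κ
  have h1 : condDiff (P ⊗ₘ κ) =ᵐ[P ⊗ₘ κ]
      fun z => ∫ y, (z.1 - y) ∂condDistrib Prod.snd Prod.fst (P ⊗ₘ κ) z.1 :=
    condExp_prod_ae_eq_integral_condDistrib (f := fun z : E d × E d => z.1 - z.2)
      measurable_fst measurable_snd.aemeasurable
      (by fun_prop : Measurable fun z : E d × E d => z.1 - z.2).stronglyMeasurable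
      (integrable_sub_compProd h hP hQ)
  have h2 : condDistrib Prod.snd Prod.fst (P ⊗ₘ κ) =ᵐ[(P ⊗ₘ κ).map Prod.fst] κ :=
    condDistrib_ae_eq_of_measure_eq_compProd Prod.fst measurable_snd.aemeasurable (by
      rw [hfst]; exact Measure.map_id)
  filter_upwards [h1, ae_of_ae_map measurable_fst.aemeasurable h2] with z hz hz'
  rw [hz, hz', drift]

lemma lintegral_condDiff_compProd {P Q : Measure (E d)} [IsProbabilityMeasure P]
    {κ : Kernel (E d) (E d)} [IsMarkovKernel κ] (h : κ ∘ₘ P = Q)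
    (hP : Integrable (fun x : E d => x) P) (hQ : Integrable (fun x : E d => x) Q) :
    ∫⁻ z, ‖condDiff (P ⊗ₘ κ) z‖ₑ ^ p ∂(P ⊗ₘ κ) = ∫⁻ x, ‖drift κ x‖ₑ ^ p ∂P := by
  have h0 : Measurable fun x => ‖drift κ x‖ₑ ^ p :=
    (stronglyMeasurable_drift κ).enorm.pow_const p
  rw [lintegral_congr_ae (g := fun z => ‖drift κ z.1‖ₑ ^ p)]
  · rw [← lintegral_map (f := fun x => ‖drift κ x‖ₑ ^ p) h0 measurable_fst]
    rw [show (P ⊗ₘ κ).map Prod.fst = P from Measure.fst_compProd P κ]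
  · filter_upwards [condDiff_compProd h hP hQ] with z hz
    rw [hz]

/-! ### Elementary properties of the weak transport quantity -/

lemma weakV_le (hp : 1 ≤ p) {P Q : PSpace d p} {κ : Kernel (E d) (E d)} [IsMarkovKernel κ]
    (h : κ ∘ₘ P.toMeasure = Q.toMeasure) : weakV P Q ≤ eLpNorm' (drift κ) p P.toMeasure := by
  refine ENNReal.rpow_le_rpow ?_ (by positivity)
  rw [← lintegral_condDiff_compProd h (P.integrable_id hp) (Q.integrable_id hp)]
  exact iInf₂_le _ (mem_Cpl_compProd h)

lemma exists_kernel_of_weakV_lt (hp : 1 ≤ p) {P Q : PSpace d p} {c : ℝ≥0∞} (hc : weakV P Q < c) :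
    ∃ κ : Kernel (E d) (E d), IsMarkovKernel κ ∧ κ ∘ₘ P.toMeasure = Q.toMeasure ∧
      eLpNorm' (drift κ) p P.toMeasure < c := by
  have hp0 : 0 < p := by positivity
  rw [weakV, one_div, ENNReal.rpow_inv_lt_iff hp0] at hc
  simp only [iInf_lt_iff] at hc
  obtain ⟨π, hπ, hlt⟩ := hc
  obtain ⟨κ, hκ, h1, rfl⟩ := exists_kernel_of_mem_Cpl hπ
  refine ⟨κ, hκ, h1, ?_⟩
  rw [lintegral_condDiff_compProd h1 (P.integrable_id hp) (Q.integrable_id hp)] at hlt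
  rwa [eLpNorm', one_div, ENNReal.rpow_inv_lt_iff hp0]

/-- Conditional Jensen: the weak transport quantity is dominated by the Wasserstein distance. -/
lemma weakV_le_wasserstein (hp : 1 ≤ p) (P Q : PSpace d p) : weakV P Q ≤ wasserstein P Q := by
  refine ENNReal.rpow_le_rpow (le_iInf₂ fun π hπ => (iInf₂_le π hπ).trans ?_) (by positivity)
  obtain ⟨κ, hκ, h1, rfl⟩ := exists_kernel_of_mem_Cpl hπ
  rw [lintegral_condDiff_compProd h1 (P.integrable_id hp) (Q.integrable_id hp),
    Measure.lintegral_compProd (by fun_prop)]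
  exact lintegral_mono fun x => enorm_integral_rpow_le hp _ (by fun_prop)

lemma wasserstein_comm (hp : 1 ≤ p) (P Q : PSpace d p) : wasserstein P Q = wasserstein Q P := by
  have key : ∀ P Q : PSpace d p, wasserstein P Q ≤ wasserstein Q P := by
    intro P Q
    refine ENNReal.rpow_le_rpow (le_iInf₂ fun π hπ => ?_) (by positivity)
    have hs : π.map Prod.swap ∈ Cpl P.toMeasure Q.toMeasure := by
      constructor
      · rw [Measure.map_map measurable_fst measurable_swap]; exact hπ.2
      · rw [Measure.map_map measurable_snd measurable_swap]; exact hπ.1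
    refine (iInf₂_le _ hs).trans_eq ?_
    rw [lintegral_map (by fun_prop) measurable_swap]
    exact lintegral_congr fun z => by rw [Prod.fst_swap, Prod.snd_swap, enorm_sub_rev]
  exact le_antisymm (key P Q) (key Q P)

lemma symV_le_wasserstein (hp : 1 ≤ p) (P Q : PSpace d p) : symV P Q ≤ wasserstein P Q :=
  max_le (weakV_le_wasserstein hp P Q)
    ((weakV_le_wasserstein hp Q P).trans_eq (wasserstein_comm hp Q P))

lemma weakV_lt_top (hp : 1 ≤ p) (P Q : PSpace d p) : weakV P Q < ∞ := by
  have h : Kernel.const (E d) Q.toMeasure ∘ₘ P.toMeasure = Q.toMeasure := by simp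
  refine (weakV_le hp h).trans_lt ?_
  have h0 : drift (Kernel.const (E d) Q.toMeasure) =
      (fun x => x) + fun _ => -∫ y, y ∂Q.toMeasure := by
    ext1 x
    rw [drift, Kernel.const_apply, integral_sub (integrable_const x) (Q.integrable_id hp)]
    simp [sub_eq_add_neg]
  rw [h0]
  refine (eLpNorm'_add_le (by fun_prop) (by fun_prop) hp).trans_lt
    (ENNReal.add_lt_top.2 ⟨P.eLpNorm_id_lt_top hp, ?_⟩)
  rw [eLpNorm'_const_of_isProbabilityMeasure _ (by positivity)]
  exact enorm_lt_top

lemma weakV_self (hp : 1 ≤ p) (P : PSpace d p) : weakV P P = 0 := by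
  have h0 : drift (Kernel.id : Kernel (E d) (E d)) = 0 := by
    ext1 x
    simp [drift, Kernel.id_apply]
  have h := weakV_le hp (P := P) (Q := P) (κ := Kernel.id) (by simp)
  rw [h0, eLpNorm'_zero (by positivity)] at h
  exact le_antisymm h bot_le

/-- The displacement of a composition is the displacement of the first kernel plus the averaged
displacement of the second. -/
lemma drift_comp {P Q R : Measure (E d)} {κ η : Kernel (E d) (E d)} [IsMarkovKernel κ]
    [IsMarkovKernel η] (hκ : κ ∘ₘ P = Q) (hη : η ∘ₘ Q = R)
    (hQ : Integrable (fun x : E d => x) Q) (hR : Integrable (fun x : E d => x) R) :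
    drift (η ∘ₖ κ) =ᵐ[P] drift κ + fun x => ∫ y, drift η y ∂κ x := by
  have hR' : (η ∘ₖ κ) ∘ₘ P = R := by rw [← Measure.comp_assoc, hκ, hη]
  have h1 : ∀ᵐ x ∂P, ∀ᵐ y ∂κ x, Integrable (fun z : E d => z) (η y) :=
    Measure.ae_ae_of_ae_comp
      (hκ ▸ Measure.ae_integrable_of_integrable_comp (hη ▸ hR))
  filter_upwards [Measure.ae_integrable_of_integrable_comp (κ := κ) (hκ ▸ hQ),
    Measure.ae_integrable_of_integrable_comp (κ := η ∘ₖ κ) (hR' ▸ hR), h1] with x hx1 hx2 hx3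
  have e : ∀ᵐ y ∂κ x, drift η y = y - ∫ z, z ∂η y := by
    filter_upwards [hx3] with y hy
    simp [drift, integral_sub (integrable_const y) hy]
  simp only [Pi.add_apply]
  rw [integral_congr_ae e, integral_sub hx1 hx2.integral_comp, drift, drift,
    integral_sub (integrable_const x) hx1, integral_sub (integrable_const x) hx2,
    Kernel.integral_comp hx2]
  simp

/-- Composing near-optimal kernels gives the triangle inequality. -/
lemma weakV_triangle (hp : 1 ≤ p) (P Q R : PSpace d p) :
    weakV P R ≤ weakV P Q + weakV Q R := by
  refine ENNReal.le_of_forall_pos_le_add fun ε hε _ => ?_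
  have hε' : (ε / 2 : ℝ≥0∞) ≠ 0 := by simpa using hε.ne'
  obtain ⟨κ, _, hκ, hκc⟩ := exists_kernel_of_weakV_lt hp
    (ENNReal.lt_add_right (weakV_lt_top hp P Q).ne hε')
  obtain ⟨η, _, hη, hηc⟩ := exists_kernel_of_weakV_lt hp
    (ENNReal.lt_add_right (weakV_lt_top hp Q R).ne hε')
  have hm : StronglyMeasurable fun x => ∫ y, drift η y ∂κ x :=
    (stronglyMeasurable_drift η).integral_kernel
  calc weakV P R ≤ eLpNorm' (drift (η ∘ₖ κ)) p P.toMeasure :=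
        weakV_le hp (by rw [← Measure.comp_assoc, hκ, hη])
    _ = eLpNorm' (drift κ + fun x => ∫ y, drift η y ∂κ x) p P.toMeasure :=
        eLpNorm'_congr_ae (drift_comp hκ hη (Q.integrable_id hp) (R.integrable_id hp))
    _ ≤ eLpNorm' (drift κ) p P.toMeasure + eLpNorm' (drift η) p Q.toMeasure :=
        (eLpNorm'_add_le (stronglyMeasurable_drift κ).aestronglyMeasurable
          hm.aestronglyMeasurable hp).trans (by
            gcongr
            exact hκ ▸ eLpNorm'_integral_kernel_le hp _ κ (stronglyMeasurable_drift η))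
    _ ≤ (weakV P Q + ε / 2) + (weakV Q R + ε / 2) := add_le_add hκc.le hηc.le
    _ = weakV P Q + weakV Q R + ε := by
        rw [add_add_add_comm, ENNReal.add_halves]

/-- A kernel carrying `Q` to `P` controls the `p`-th moment of `Q` by that of `P`. -/
lemma eLpNorm'_id_le (hp : 1 ≤ p) {P Q : PSpace d p} {κ : Kernel (E d) (E d)} [IsMarkovKernel κ]
    (h : κ ∘ₘ Q.toMeasure = P.toMeasure) :
    eLpNorm' (fun x => x) p Q.toMeasure ≤
      eLpNorm' (drift κ) p Q.toMeasure + eLpNorm' (fun x => x) p P.toMeasure := by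
  have hm : StronglyMeasurable fun x => ∫ y, y ∂κ x :=
    (stronglyMeasurable_id (α := E d)).integral_kernel
  have e : (fun x => x) =ᵐ[Q.toMeasure] drift κ + fun x => ∫ y, y ∂κ x := by
    filter_upwards [Measure.ae_integrable_of_integrable_comp (κ := κ) (h ▸ P.integrable_id hp)]
      with x hx
    simp [drift, integral_sub (integrable_const x) hx]
  rw [eLpNorm'_congr_ae e]
  refine (eLpNorm'_add_le (stronglyMeasurable_drift κ).aestronglyMeasurable
    hm.aestronglyMeasurable hp).trans ?_
  gcongr
  exact h ▸ eLpNorm'_integral_kernel_le hp _ κ stronglyMeasurable_id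

end WeakTransport
namespace WeakTransport

variable {d : ℕ} {p : ℝ}

/-! ### A strictly convex function of linear growth -/

/-- The strictly convex `1`-Lipschitz function `x ↦ √(1 + ‖x‖²)`. -/
noncomputable def hyp (x : E d) : ℝ := √(1 + ‖x‖ ^ 2)

/-- The gradient of `hyp`. -/
noncomputable def hypGrad (x : E d) : E d := (hyp x)⁻¹ • x

/-- The Bregman divergence of `hyp`: the gap at `y` above the tangent plane at `x`. -/
noncomputable def bregman (x y : E d) : ℝ := hyp y - hyp x + inner ℝ (hypGrad x) (x - y)

lemma hyp_sq (x : E d) : hyp x ^ 2 = 1 + ‖x‖ ^ 2 := Real.sq_sqrt (by positivity)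

lemma one_le_hyp (x : E d) : 1 ≤ hyp x := Real.one_le_sqrt.2 (by nlinarith [sq_nonneg ‖x‖])

lemma hyp_le (x : E d) : hyp x ≤ 1 + ‖x‖ :=
  Real.sqrt_le_iff.2 ⟨by positivity, by nlinarith [norm_nonneg x]⟩

lemma norm_hypGrad_le (x : E d) : ‖hypGrad x‖ ≤ 1 := by
  have h := one_le_hyp x
  rw [hypGrad, norm_smul, Real.norm_of_nonneg (by positivity), inv_mul_le_iff₀ (by positivity),
    mul_one]
  exact Real.le_sqrt_of_sq_le (by linarith)

lemma measurable_hyp : Measurable (hyp : E d → ℝ) := by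
  unfold hyp; fun_prop

lemma measurable_hypGrad : Measurable (hypGrad : E d → E d) :=
  measurable_hyp.inv.smul measurable_id

lemma hyp_mul_bregman (x y : E d) : hyp x * bregman x y = hyp x * hyp y - 1 - inner ℝ x y := by
  have h := one_le_hyp x
  have hs := hyp_sq x
  rw [bregman, hypGrad, real_inner_smul_left, inner_sub_right, real_inner_self_eq_norm_sq]
  field_simp
  linarith

/-- The divergence is quadratic near the diagonal and linear far away from it. It
measures the defect in the Cauchy-Schwarz inequality for the vectors `(1, x)` and `(1, y)`, whose
norms are `hyp x` and `hyp y`. -/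
lemma norm_sub_sq_le (x y : E d) :
    ‖y - x‖ ^ 2 ≤ 2 * hyp x ^ 2 * hyp y * bregman x y := by
  have hx := one_le_hyp x
  have hy := one_le_hyp y
  have hc := abs_le.1 (abs_real_inner_le_norm x y)
  have hb := hyp_mul_bregman x y
  have hsq : inner ℝ x y ^ 2 ≤ ‖x‖ ^ 2 * ‖y‖ ^ 2 := by
    rw [← mul_pow]; exact sq_le_sq' hc.1 hc.2
  have hprod : (hyp x * hyp y) ^ 2 = (1 + ‖x‖ ^ 2) * (1 + ‖y‖ ^ 2) := by
    rw [mul_pow, hyp_sq, hyp_sq]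
  have hle : 1 + inner ℝ x y ≤ hyp x * hyp y := by
    refine le_of_sq_le_sq ?_ (by positivity)
    rw [hprod]
    nlinarith [sq_nonneg (‖x‖ - ‖y‖)]
  have hd : ‖y - x‖ ^ 2 = ‖y‖ ^ 2 - 2 * inner ℝ x y + ‖x‖ ^ 2 := by
    rw [norm_sub_sq_real, real_inner_comm]
  calc ‖y - x‖ ^ 2 ≤ (hyp x * hyp y) ^ 2 - (1 + inner ℝ x y) ^ 2 := by
        rw [hprod, hd]; nlinarith
    _ = (hyp x * hyp y - 1 - inner ℝ x y) * (hyp x * hyp y + (1 + inner ℝ x y)) := by ring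
    _ ≤ (hyp x * hyp y - 1 - inner ℝ x y) * (hyp x * hyp y + hyp x * hyp y) := by
        gcongr; linarith
    _ = 2 * hyp x ^ 2 * hyp y * bregman x y := by rw [← hb]; ring

lemma bregman_nonneg (x y : E d) : 0 ≤ bregman x y := by
  have hx := one_le_hyp x
  have hy := one_le_hyp y
  have h := (sq_nonneg _).trans (norm_sub_sq_le x y)
  exact nonneg_of_mul_nonneg_right h (by positivity)

/-- On bounded sets of base points the divergence controls the distance. -/
lemma norm_sub_le_add_bregman (R : ℝ) (hR : 0 ≤ R) {η : ℝ} (hη : 0 < η) :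
    ∃ C : ℝ, 0 ≤ C ∧ ∀ x y : E d, ‖x‖ ≤ R → ‖y - x‖ ≤ η + C * bregman x y := by
  refine ⟨2 * (1 + R) ^ 2 * ((1 + R) / η + 1), by positivity, fun x y hx => ?_⟩
  have hD := bregman_nonneg x y
  rcases le_total ‖y - x‖ η with h | h
  · have : 0 ≤ 2 * (1 + R) ^ 2 * ((1 + R) / η + 1) * bregman x y := by positivity
    linarith
  · have ht : 0 < ‖y - x‖ := hη.trans_le h
    have hy : hyp y ≤ ((1 + R) / η + 1) * ‖y - x‖ := by
      have h1 : ‖y‖ ≤ ‖x‖ + ‖y - x‖ := norm_le_norm_add_norm_sub' y x |>.trans_eq (by ring)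
      have h2 : 1 + R ≤ (1 + R) / η * ‖y - x‖ := by
        rw [div_mul_eq_mul_div, le_div_iff₀ hη]; gcongr
      linarith [hyp_le y]
    have hy0 : 0 ≤ hyp y := zero_le_one.trans (one_le_hyp y)
    have hx1 := one_le_hyp x
    have hx2 : hyp x ≤ 1 + R := (hyp_le x).trans (by linarith)
    have h3 : ‖y - x‖ * ‖y - x‖ ≤
        (2 * (1 + R) ^ 2 * ((1 + R) / η + 1) * bregman x y) * ‖y - x‖ := by
      calc ‖y - x‖ * ‖y - x‖ ≤ 2 * hyp x ^ 2 * hyp y * bregman x y := by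
            rw [← sq]; exact norm_sub_sq_le x y
        _ ≤ 2 * (1 + R) ^ 2 * (((1 + R) / η + 1) * ‖y - x‖) * bregman x y := by gcongr
        _ = _ := by ring
    linarith [le_of_mul_le_mul_right h3 ht]

/-! ### The pointwise comparison -/

lemma add_rpow_le_two_rpow (hp : 1 ≤ p) {a b : ℝ} (ha : 0 ≤ a) (hb : 0 ≤ b) :
    (a + b) ^ p ≤ 2 ^ (p - 1) * (a ^ p + b ^ p) := by
  lift a to NNReal using ha
  lift b to NNReal using hb
  exact_mod_cast NNReal.rpow_add_le_mul_rpow_add_rpow a b hp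

/-- The tangent-line inequality for `s ↦ s ^ p` at `a`. -/
lemma rpow_sub_rpow_le (hp : 1 ≤ p) {a b : ℝ} (ha : 0 ≤ a) (hb : 0 ≤ b) :
    a ^ p - b ^ p ≤ p * a ^ (p - 1) * (a - b) := by
  rcases ha.eq_or_lt with rfl | ha
  · rw [Real.zero_rpow (by positivity)]
    rcases hp.eq_or_lt with rfl | hp
    · simp
    · rw [Real.zero_rpow (by linarith)]
      have := Real.rpow_nonneg hb p
      simpa
  · have h := one_add_mul_self_le_rpow_one_add (s := b / a - 1) (by
      have : 0 ≤ b / a := by positivity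
      linarith) hp
    rw [add_sub_cancel, Real.div_rpow hb ha.le, le_div_iff₀ (by positivity)] at h
    have e : a ^ p = a ^ (p - 1) * a := by
      rw [← Real.rpow_add_one ha.ne', sub_add_cancel]
    have e2 : (1 + p * (b / a - 1)) * a ^ p = a ^ p - p * a ^ (p - 1) * (a - b) := by
      rw [e]; field_simp; ring
    linarith

/-- The `p`-th power of the displacement is bounded by an increment of `‖·‖ ^ p`, a tail of the base
point, and the Bregman divergence. The three expectations are small for a kernel with small
displacement. -/
lemma norm_sub_rpow_le (hp : 1 ≤ p) (R : ℝ) (hR : 0 ≤ R) {η : ℝ} (hη : 0 < η) :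
    ∃ C : ℝ, 0 ≤ C ∧ ∀ x y : E d, ‖x - y‖ ^ p ≤
      2 ^ (p - 1) * (‖y‖ ^ p - ‖x‖ ^ p) +
        2 * 2 ^ (p - 1) * {x : E d | R < ‖x‖}.indicator (fun x => ‖x‖ ^ p) x +
        η + C * bregman x y := by
  set K : ℝ := 2 ^ (p - 1) with hK
  have hK0 : 0 < K := by positivity
  set C₁ : ℝ := 1 + K * (p * R ^ (p - 1)) + 2 * K * R ^ p with hC₁
  have hC₁0 : 1 ≤ C₁ := by
    have : 0 ≤ K * (p * R ^ (p - 1)) + 2 * K * R ^ p := by positivity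
    linarith
  obtain ⟨C, hC, h⟩ := norm_sub_le_add_bregman (d := d) R hR (η := η / C₁) (by positivity)
  refine ⟨C₁ * C, by positivity, fun x y => ?_⟩
  have hD := bregman_nonneg x y
  have h1 : ‖x - y‖ ^ p ≤ K * (‖x‖ ^ p + ‖y‖ ^ p) :=
    (Real.rpow_le_rpow (norm_nonneg _) (norm_sub_le x y) (by positivity)).trans
      (add_rpow_le_two_rpow hp (norm_nonneg x) (norm_nonneg y))
  -- For a base point in the tail, convexity of `s ↦ s ^ p` suffices.
  rcases lt_or_ge R ‖x‖ with hx | hx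
  · rw [Set.indicator_of_mem (by exact hx)]
    have : 0 ≤ C₁ * C * bregman x y := by positivity
    linarith
  · rw [Set.indicator_of_notMem (by simpa using hx), mul_zero, add_zero]
    have ht : C₁ * ‖x - y‖ ≤ η + C₁ * C * bregman x y := by
      rw [norm_sub_rev]
      calc C₁ * ‖y - x‖ ≤ C₁ * (η / C₁ + C * bregman x y) := by gcongr; exact h x y hx
        _ = _ := by field_simp
    -- On the ball of radius `R` a multiple of the displacement itself may be spent: the tangent
    -- line at `‖x‖` pays for short displacements, and `‖x‖ ^ p ≤ R ^ p ‖x - y‖` for the others.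
    suffices hs : ‖x - y‖ ^ p ≤ K * (‖y‖ ^ p - ‖x‖ ^ p) + C₁ * ‖x - y‖ by linarith
    have hA : 0 ≤ K * (p * R ^ (p - 1)) := by positivity
    have hB : 0 ≤ 2 * K * R ^ p := by positivity
    have hn := norm_nonneg (x - y)
    rcases le_total ‖x - y‖ 1 with h2 | h2
    · have h3 : ‖x - y‖ ^ p ≤ ‖x - y‖ := by
        simpa using Real.rpow_le_rpow_of_exponent_ge_of_imp (norm_nonneg (x - y)) h2 hp
          (by intro _; simp; positivity)
      have h4 : ‖x‖ ^ p - ‖y‖ ^ p ≤ p * R ^ (p - 1) * ‖x - y‖ :=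
        (rpow_sub_rpow_le hp (norm_nonneg x) (norm_nonneg y)).trans <| by
          calc p * ‖x‖ ^ (p - 1) * (‖x‖ - ‖y‖) ≤ p * ‖x‖ ^ (p - 1) * ‖x - y‖ := by
                gcongr; exact norm_sub_norm_le x y
            _ ≤ _ := by gcongr
      have h5 := mul_le_mul_of_nonneg_left h4 hK0.le
      rw [hC₁]
      nlinarith [mul_nonneg hB hn]
    · have h6 : ‖x‖ ^ p ≤ R ^ p := Real.rpow_le_rpow (norm_nonneg x) hx (by positivity)
      have h7 : 2 * K * ‖x‖ ^ p ≤ 2 * K * R ^ p := by gcongr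
      rw [hC₁]
      nlinarith [mul_nonneg hA hn, mul_le_mul_of_nonneg_left h2 hB]

end WeakTransport
namespace WeakTransport

variable {d : ℕ} {p : ℝ}

/-! ### Small weak transport forces small Wasserstein distance -/

lemma PSpace.integrable_hyp (hp : 1 ≤ p) (P : PSpace d p) : Integrable hyp P.toMeasure := by
  refine ((integrable_const 1).add (P.integrable_id hp).norm).mono'
    measurable_hyp.aestronglyMeasurable (.of_forall fun x => ?_)
  rw [Real.norm_of_nonneg (zero_le_one.trans (one_le_hyp x))]
  exact hyp_le x

lemma PSpace.integral_norm_rpow (hp : 1 ≤ p) (P : PSpace d p) :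
    ∫ x, ‖x‖ ^ p ∂P.toMeasure = (eLpNorm' (fun x => x) p P.toMeasure).toReal ^ p := by
  rw [eLpNorm', ← ENNReal.toReal_rpow, ← Real.rpow_mul ENNReal.toReal_nonneg,
    one_div_mul_cancel (by positivity), Real.rpow_one, integral_eq_lintegral_of_nonneg_ae
      (.of_forall fun x => by positivity) (measurable_norm.pow_const p).aestronglyMeasurable]
  congr 1
  refine lintegral_congr fun x => ?_
  rw [← ENNReal.ofReal_rpow_of_nonneg (norm_nonneg x) (by positivity), ofReal_norm]

section Coupling

variable {P Q : PSpace d p} {κ : Kernel (E d) (E d)} [IsMarkovKernel κ]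

lemma integrable_comp_fst (κ : Kernel (E d) (E d)) [IsMarkovKernel κ] {f : E d → ℝ}
    (hf : Integrable f P.toMeasure) :
    Integrable (fun z : E d × E d => f z.1) (P.toMeasure ⊗ₘ κ) := by
  have h1 : (P.toMeasure ⊗ₘ κ).map Prod.fst = P.toMeasure := Measure.fst_compProd _ κ
  exact (h1.symm ▸ hf).comp_measurable measurable_fst

lemma integrable_comp_snd (h : κ ∘ₘ P.toMeasure = Q.toMeasure) {f : E d → ℝ}
    (hf : Integrable f Q.toMeasure) :
    Integrable (fun z : E d × E d => f z.2) (P.toMeasure ⊗ₘ κ) :=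
  ((mem_Cpl_compProd h).2.symm ▸ hf).comp_measurable measurable_snd

lemma integral_comp_fst (κ : Kernel (E d) (E d)) [IsMarkovKernel κ] {f : E d → ℝ}
    (hf : Integrable f P.toMeasure) :
    ∫ z, f z.1 ∂(P.toMeasure ⊗ₘ κ) = ∫ x, f x ∂P.toMeasure := by
  have h1 : (P.toMeasure ⊗ₘ κ).map Prod.fst = P.toMeasure := Measure.fst_compProd _ κ
  rw [← integral_map measurable_fst.aemeasurable (by rw [h1]; exact hf.1), h1]

lemma integral_comp_snd (h : κ ∘ₘ P.toMeasure = Q.toMeasure) {f : E d → ℝ}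
    (hf : Integrable f Q.toMeasure) :
    ∫ z, f z.2 ∂(P.toMeasure ⊗ₘ κ) = ∫ y, f y ∂Q.toMeasure := by
  have h1 := (mem_Cpl_compProd h).2
  rw [← integral_map measurable_snd.aemeasurable (by rw [h1]; exact hf.1), h1]

lemma integral_norm_drift_le (hp : 1 ≤ p) {δ : ℝ} (hδ : 0 ≤ δ)
    (hc : eLpNorm' (drift κ) p P.toMeasure ≤ ENNReal.ofReal δ) :
    Integrable (drift κ) P.toMeasure ∧ ∫ x, ‖drift κ x‖ ∂P.toMeasure ≤ δ := by
  have hm := (stronglyMeasurable_drift κ).aestronglyMeasurable (μ := P.toMeasure)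
  have h := (eLpNorm'_le_eLpNorm'_of_exponent_le one_pos hp _ hm).trans hc
  simp only [eLpNorm', ENNReal.rpow_one, div_one] at h
  refine ⟨⟨hm, h.trans_lt ENNReal.ofReal_lt_top⟩, ?_⟩
  rw [integral_norm_eq_lintegral_enorm hm]
  exact ENNReal.toReal_le_of_le_ofReal hδ h

lemma integrable_hypGrad_inner (hp : 1 ≤ p) (h : κ ∘ₘ P.toMeasure = Q.toMeasure) :
    Integrable (fun z : E d × E d => inner ℝ (hypGrad z.1) (z.1 - z.2)) (P.toMeasure ⊗ₘ κ) := by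
  refine (integrable_sub_compProd h (P.integrable_id hp) (Q.integrable_id hp)).norm.mono'
    ((measurable_hypGrad.comp measurable_fst).inner
      (measurable_fst.sub measurable_snd)).aestronglyMeasurable (.of_forall fun z => ?_)
  refine (abs_real_inner_le_norm _ _).trans ?_
  exact mul_le_of_le_one_left (norm_nonneg _) (norm_hypGrad_le _)

lemma integrable_bregman (hp : 1 ≤ p) (h : κ ∘ₘ P.toMeasure = Q.toMeasure) :
    Integrable (fun z : E d × E d => bregman z.1 z.2) (P.toMeasure ⊗ₘ κ) :=
  ((integrable_comp_snd h (Q.integrable_hyp hp)).sub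
    (integrable_comp_fst κ (P.integrable_hyp hp))).add (integrable_hypGrad_inner hp h)

/-- Conditioning on the first variable replaces the displacement by its conditional mean in the
first-order term, so the expected divergence is the increment of `∫ hyp` up to the size of the
drift. -/
lemma integral_bregman_le (hp : 1 ≤ p) (h : κ ∘ₘ P.toMeasure = Q.toMeasure) {δ : ℝ} (hδ : 0 ≤ δ)
    (hc : eLpNorm' (drift κ) p P.toMeasure ≤ ENNReal.ofReal δ) :
    ∫ z, bregman z.1 z.2 ∂(P.toMeasure ⊗ₘ κ) ≤
      ∫ y, hyp y ∂Q.toMeasure - ∫ x, hyp x ∂P.toMeasure + δ := by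
  obtain ⟨hi, hle⟩ := integral_norm_drift_le hp hδ hc
  have hsub := integrable_sub_compProd h (P.integrable_id hp) (Q.integrable_id hp)
  have hg : ∫ z, inner ℝ (hypGrad z.1) (z.1 - z.2) ∂(P.toMeasure ⊗ₘ κ) ≤ δ := by
    rw [Measure.integral_compProd (integrable_hypGrad_inner hp h)]
    calc ∫ x, ∫ y, inner ℝ (hypGrad x) (x - y) ∂κ x ∂P.toMeasure
        ≤ ∫ x, ‖drift κ x‖ ∂P.toMeasure := by
          refine (Real.le_norm_self _).trans (norm_integral_le_of_norm_le hi.norm ?_)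
          filter_upwards [((Measure.integrable_compProd_iff hsub.1).1 hsub).1] with x hx
          rw [integral_inner hx]
          exact (abs_real_inner_le_norm _ _).trans
            (mul_le_of_le_one_left (norm_nonneg _) (norm_hypGrad_le _))
      _ ≤ δ := hle
  have i1 := integrable_comp_snd h (Q.integrable_hyp hp)
  have i2 := integrable_comp_fst κ (P.integrable_hyp hp)
  simp only [bregman]
  rw [integral_add (by exact i1.sub i2) (integrable_hypGrad_inner hp h), integral_sub i1 i2,
    integral_comp_snd h (Q.integrable_hyp hp), integral_comp_fst κ (P.integrable_hyp hp)]
  linarith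

end Coupling

lemma PSpace.tendsto_tail (hp : 1 ≤ p) (P : PSpace d p) :
    Tendsto (fun n : ℕ => ∫ x, {x : E d | (n : ℝ) < ‖x‖}.indicator (fun x => ‖x‖ ^ p) x
      ∂P.toMeasure) atTop (𝓝 0) := by
  have h : Tendsto (fun n : ℕ => ∫ x, {x : E d | (n : ℝ) < ‖x‖}.indicator (fun x => ‖x‖ ^ p) x
      ∂P.toMeasure) atTop (𝓝 (∫ _, 0 ∂P.toMeasure)) := by
    refine tendsto_integral_of_dominated_convergence (fun x => ‖x‖ ^ p) (fun n => ?_)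
      (P.integrable_norm_rpow hp) (fun n => .of_forall fun x => ?_) (.of_forall fun x => ?_)
    · exact ((measurable_norm.pow_const p).indicator
        (measurableSet_lt measurable_const measurable_norm)).aestronglyMeasurable
    · refine (norm_indicator_le_norm_self _ x).trans_eq (Real.norm_of_nonneg (by positivity))
    · obtain ⟨N, hN⟩ := exists_nat_ge ‖x‖
      refine tendsto_const_nhds.congr' ?_
      filter_upwards [eventually_ge_atTop N] with n hn
      have : (N : ℝ) ≤ n := by exact_mod_cast hn
      rw [Set.indicator_of_notMem]
      simpa using hN.trans this
  simpa using h

/-- The pointwise comparison integrated along a kernel from `P` to `Q` with small displacement. The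
kernel from `Q` back to `P` bounds `∫ hyp ∂Q` and the `p`-th moment of `Q`. -/
lemma lintegral_norm_sub_rpow_le (hp : 1 ≤ p) {R η C : ℝ} (hC : 0 ≤ C)
    (hb : ∀ x y : E d, ‖x - y‖ ^ p ≤ 2 ^ (p - 1) * (‖y‖ ^ p - ‖x‖ ^ p) +
        2 * 2 ^ (p - 1) * {x : E d | R < ‖x‖}.indicator (fun x => ‖x‖ ^ p) x +
        η + C * bregman x y)
    {P Q : PSpace d p} {δ : ℝ} (hδ : 0 ≤ δ) (h : symV P Q < ENNReal.ofReal δ) :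
    wasserstein P Q ≤ ENNReal.ofReal (2 ^ (p - 1) *
      (((eLpNorm' (fun x => x) p P.toMeasure).toReal + δ) ^ p -
        (eLpNorm' (fun x => x) p P.toMeasure).toReal ^ p) +
        2 * 2 ^ (p - 1) * ∫ x, {x : E d | R < ‖x‖}.indicator (fun x => ‖x‖ ^ p) x ∂P.toMeasure +
        η + C * (2 * δ)) ^ (1 / p) := by
  obtain ⟨κ, _, hκ, hκc⟩ := exists_kernel_of_weakV_lt hp ((le_max_left _ _).trans_lt h)
  obtain ⟨ν, _, hν, hνc⟩ := exists_kernel_of_weakV_lt hp ((le_max_right _ _).trans_lt h)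
  set M := (eLpNorm' (fun x => x) p P.toMeasure).toReal
  have hQM : ∫ y, ‖y‖ ^ p ∂Q.toMeasure ≤ (M + δ) ^ p := by
    rw [Q.integral_norm_rpow hp]
    refine Real.rpow_le_rpow ENNReal.toReal_nonneg ?_ (by positivity)
    refine ENNReal.toReal_le_of_le_ofReal (by positivity) ((eLpNorm'_id_le hp hν).trans ?_)
    rw [ENNReal.ofReal_add ENNReal.toReal_nonneg hδ, ENNReal.ofReal_toReal
      (P.eLpNorm_id_lt_top hp).ne, add_comm]
    gcongr
  -- The divergence along `ν` is nonnegative, which bounds `∫ hyp ∂Q - ∫ hyp ∂P` by `δ`.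
  have hB : ∫ z, bregman z.1 z.2 ∂(P.toMeasure ⊗ₘ κ) ≤ 2 * δ := by
    have h1 := integral_bregman_le hp hκ hδ hκc.le
    have h2 := integral_bregman_le hp hν hδ hνc.le
    have h3 : 0 ≤ ∫ z, bregman z.1 z.2 ∂(Q.toMeasure ⊗ₘ ν) :=
      integral_nonneg fun z => bregman_nonneg _ _
    linarith
  have i1 := integrable_comp_snd hκ (Q.integrable_norm_rpow hp)
  have i2 := integrable_comp_fst κ (P.integrable_norm_rpow hp)
  have j3 : Integrable ({x : E d | R < ‖x‖}.indicator (fun x => ‖x‖ ^ p)) P.toMeasure :=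
    (P.integrable_norm_rpow hp).indicator (measurableSet_lt measurable_const measurable_norm)
  have i3 := integrable_comp_fst κ j3
  have i4 := integrable_bregman hp hκ
  have i12 : Integrable (fun z : E d × E d => 2 ^ (p - 1) * (‖z.2‖ ^ p - ‖z.1‖ ^ p))
      (P.toMeasure ⊗ₘ κ) := (i1.sub i2).const_mul _
  have i123 := i12.fun_add (i3.const_mul (2 * 2 ^ (p - 1)))
  have i1234 := i123.fun_add (integrable_const η)
  have itot := i1234.fun_add (i4.const_mul C)
  refine ENNReal.rpow_le_rpow ((iInf₂_le _ (mem_Cpl_compProd hκ)).trans ?_) (by positivity)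
  calc ∫⁻ z, ‖z.1 - z.2‖ₑ ^ p ∂(P.toMeasure ⊗ₘ κ)
      ≤ ∫⁻ z, ENNReal.ofReal (2 ^ (p - 1) * (‖z.2‖ ^ p - ‖z.1‖ ^ p) +
        2 * 2 ^ (p - 1) * {x : E d | R < ‖x‖}.indicator (fun x => ‖x‖ ^ p) z.1 +
        η + C * bregman z.1 z.2) ∂(P.toMeasure ⊗ₘ κ) := by
        refine lintegral_mono fun z => ?_
        rw [← ofReal_norm, ENNReal.ofReal_rpow_of_nonneg (norm_nonneg _) (by positivity)]
        exact ENNReal.ofReal_le_ofReal (hb z.1 z.2)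
    _ = ENNReal.ofReal (∫ z, (2 ^ (p - 1) * (‖z.2‖ ^ p - ‖z.1‖ ^ p) +
        2 * 2 ^ (p - 1) * {x : E d | R < ‖x‖}.indicator (fun x => ‖x‖ ^ p) z.1 +
        η + C * bregman z.1 z.2) ∂(P.toMeasure ⊗ₘ κ)) :=
        (ofReal_integral_eq_lintegral_ofReal itot (.of_forall fun z =>
          (by positivity : 0 ≤ ‖z.1 - z.2‖ ^ p).trans (hb z.1 z.2))).symm
    _ ≤ _ := by
        refine ENNReal.ofReal_le_ofReal ?_
        rw [integral_add i1234 (i4.const_mul C), integral_add i123 (integrable_const η),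
          integral_add i12 (i3.const_mul _), integral_const_mul, integral_const_mul,
          integral_const_mul, integral_sub i1 i2,
          integral_comp_snd hκ (Q.integrable_norm_rpow hp),
          integral_comp_fst κ (P.integrable_norm_rpow hp), integral_comp_fst κ j3,
          P.integral_norm_rpow hp, integral_const, probReal_univ, one_smul]
        gcongr

/-- Every Wasserstein ball around `P` contains a ball of the symmetrized weak transport metric. -/
lemma exists_symV_lt_imp_wasserstein_lt (hp : 1 ≤ p) (P : PSpace d p) {ε : ℝ≥0∞} (hε : 0 < ε) :
    ∃ δ : ℝ≥0∞, 0 < δ ∧ ∀ Q, symV P Q < δ → wasserstein P Q < ε := by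
  have hp0 : 0 < p := by positivity
  obtain ⟨e, he, heε⟩ : ∃ e : ℝ, 0 < e ∧ ENNReal.ofReal e ^ (1 / p) < ε := by
    have hc : Tendsto (fun e : ℝ => ENNReal.ofReal e ^ (1 / p)) (𝓝[>] 0) (𝓝 0) := by
      have := ((ENNReal.continuous_rpow_const (y := 1 / p)).comp
        ENNReal.continuous_ofReal).tendsto 0
      simp only [Function.comp_def, ENNReal.ofReal_zero,
        ENNReal.zero_rpow_of_pos (show 0 < 1 / p by positivity)] at this
      exact this.mono_left nhdsWithin_le_nhds
    obtain ⟨e, h1, h2⟩ := ((hc.eventually_lt_const hε).and self_mem_nhdsWithin).exists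
    exact ⟨e, h2, h1⟩
  -- The tail radius `n` depends on `P` and `e` only, hence so does the constant `C`; the bound `δ`
  -- on the drifts is chosen last.
  obtain ⟨n, hn⟩ := (((P.tendsto_tail hp).const_mul (2 * 2 ^ (p - 1))).eventually_lt_const
    (show 2 * 2 ^ (p - 1) * 0 < e / 3 by rw [mul_zero]; positivity)).exists
  obtain ⟨C, hC, hb⟩ := norm_sub_rpow_le (d := d) hp n n.cast_nonneg (η := e / 3) (by positivity)
  set M := (eLpNorm' (fun x => x) p P.toMeasure).toReal with hM
  obtain ⟨δ, hδ0, hδ⟩ : ∃ δ : ℝ, 0 < δ ∧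
      2 ^ (p - 1) * ((M + δ) ^ p - M ^ p) + C * (2 * δ) < e / 3 := by
    have hc : Continuous fun δ : ℝ =>
        2 ^ (p - 1) * ((M + δ) ^ p - M ^ p) + C * (2 * δ) := by
      have := (continuous_const.add continuous_id : Continuous fun δ : ℝ => M + δ).rpow_const
        (p := p) fun _ => Or.inr hp0.le
      fun_prop
    have := (hc.tendsto 0).mono_left (nhdsWithin_le_nhds (s := Set.Ioi 0))
    obtain ⟨δ, h1, h2⟩ := ((this.eventually_lt_const (show _ < e / 3 by
      simp only [add_zero, sub_self, mul_zero]; positivity)).and self_mem_nhdsWithin).exists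
    exact ⟨δ, h2, h1⟩
  refine ⟨ENNReal.ofReal δ, ENNReal.ofReal_pos.2 hδ0, fun Q hQ => ?_⟩
  refine (lintegral_norm_sub_rpow_le hp hC hb hδ0.le hQ).trans_lt (lt_of_le_of_lt ?_ heε)
  refine ENNReal.rpow_le_rpow (ENNReal.ofReal_le_ofReal ?_) (by positivity)
  rw [← hM]
  linarith

/-! ### The metric -/

/-- The characteristic function is continuous with respect to the Wasserstein distance, hence the
latter separates points. -/
lemma eq_of_wasserstein_eq_zero (hp : 1 ≤ p) {P Q : PSpace d p} (h : wasserstein P Q = 0) :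
    P = Q := by
  suffices hPQ : P.toMeasure = Q.toMeasure from Subtype.ext (Subtype.ext hPQ)
  refine Measure.ext_of_charFun (funext fun t => ?_)
  rw [← sub_eq_zero, ← enorm_eq_zero]
  have key : ∀ ε : ℝ≥0∞, 0 < ε →
      ‖charFun P.toMeasure t - charFun Q.toMeasure t‖ₑ ≤ ‖t‖ₑ * ε := by
    intro ε hε
    have hlt : wasserstein P Q < ε := h ▸ hε
    rw [wasserstein, one_div, ENNReal.rpow_inv_lt_iff (by positivity)] at hlt
    simp only [iInf_lt_iff] at hlt
    obtain ⟨π, hπ, hlt⟩ := hlt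
    have : IsProbabilityMeasure (π.map Prod.fst) := by rw [hπ.1]; infer_instance
    have : IsProbabilityMeasure π := Measure.isProbabilityMeasure_of_map Prod.fst
    have hm : Measurable fun x : E d => Complex.exp (inner ℝ x t * Complex.I) := by fun_prop
    have hi : ∀ f : E d × E d → E d, Measurable f →
        Integrable (fun z => Complex.exp (inner ℝ (f z) t * Complex.I)) π := fun f hf =>
      (integrable_const (1 : ℝ)).mono' (hm.comp hf).aestronglyMeasurable
        (.of_forall fun z => (Complex.norm_exp_ofReal_mul_I _).le)
    have h1 : ∫⁻ z, ‖z.1 - z.2‖ₑ ∂π ≤ ε := by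
      have := eLpNorm'_le_eLpNorm'_of_exponent_le one_pos hp π
        (by fun_prop : AEStronglyMeasurable (fun z : E d × E d => z.1 - z.2) π)
      simp only [eLpNorm', ENNReal.rpow_one, div_one] at this
      refine this.trans ?_
      rw [one_div, ENNReal.rpow_inv_le_iff (by positivity)]
      exact hlt.le
    rw [charFun_apply, charFun_apply, ← hπ.1, ← hπ.2,
      integral_map measurable_fst.aemeasurable hm.aestronglyMeasurable,
      integral_map measurable_snd.aemeasurable hm.aestronglyMeasurable,
      ← integral_sub (hi _ measurable_fst) (hi _ measurable_snd)]
    refine (enorm_integral_le_lintegral_enorm _).trans ?_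
    calc ∫⁻ z, ‖Complex.exp (inner ℝ z.1 t * Complex.I) -
            Complex.exp (inner ℝ z.2 t * Complex.I)‖ₑ ∂π
        ≤ ∫⁻ z, ‖t‖ₑ * ‖z.1 - z.2‖ₑ ∂π := by
          refine lintegral_mono fun z => ?_
          rw [← enorm_norm t, ← enorm_norm (z.1 - z.2), ← enorm_mul]
          refine enorm_le_iff_norm_le.2 ?_
          rw [Real.norm_of_nonneg (by positivity)]
          have e : Complex.exp (inner ℝ z.1 t * Complex.I) -
              Complex.exp (inner ℝ z.2 t * Complex.I) =
              Complex.exp (inner ℝ z.2 t * Complex.I) *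
                (Complex.exp (Complex.I * (inner ℝ (z.1 - z.2) t : ℝ)) - 1) := by
            rw [mul_sub, ← Complex.exp_add, inner_sub_left]
            push_cast
            ring_nf
          rw [e, norm_mul, Complex.norm_exp_ofReal_mul_I, one_mul]
          refine Real.norm_exp_I_mul_ofReal_sub_one_le.trans ?_
          rw [mul_comm]
          exact abs_real_inner_le_norm _ _
      _ = ‖t‖ₑ * ∫⁻ z, ‖z.1 - z.2‖ₑ ∂π := lintegral_const_mul _ (by fun_prop)
      _ ≤ ‖t‖ₑ * ε := by gcongr
  refine le_antisymm (ENNReal.le_of_forall_pos_le_add fun ε hε _ => ?_) bot_le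
  -- For `t = 0` the quotient is `∞`, which `key` admits, and `0 * ∞ = 0`.
  have h2 := key (ε / ‖t‖ₑ) (ENNReal.div_pos (by simpa using hε.ne') enorm_ne_top)
  rw [zero_add]
  exact h2.trans ENNReal.mul_div_le

lemma eq_of_symV_eq_zero (hp : 1 ≤ p) {P Q : PSpace d p} (h : symV P Q = 0) : P = Q := by
  refine eq_of_wasserstein_eq_zero hp (le_antisymm (le_of_forall_pos_le_add fun ε hε => ?_) bot_le)
  obtain ⟨δ, hδ, hPQ⟩ := exists_symV_lt_imp_wasserstein_lt hp P hε
  simpa using (hPQ Q (h ▸ hδ)).le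

/-- The extended metric `symV`, with the uniformity it generates. -/
noncomputable abbrev symVEMetricSpace (d : ℕ) (hp : 1 ≤ p) : EMetricSpace (PSpace d p) where
  edist := symV
  edist_self P := by simp [symV, weakV_self hp]
  edist_comm P Q := max_comm _ _
  edist_triangle P Q R := max_le
    ((weakV_triangle hp P Q R).trans (add_le_add (le_max_left _ _) (le_max_left _ _)))
    ((weakV_triangle hp R Q P).trans (by
      rw [add_comm]; exact add_le_add (le_max_right _ _) (le_max_right _ _)))
  eq_of_edist_eq_zero := eq_of_symV_eq_zero hp

end WeakTransport

theorem mainTheorem3 (d : ℕ) (p : ℝ) (hp : 1 ≤ p) :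
    ∃ m : MetricSpace (WeakTransport.PSpace d p),
      (∀ P Q : WeakTransport.PSpace d p, edist P Q = WeakTransport.symV P Q) ∧
      m.toPseudoMetricSpace.toUniformSpace.toTopologicalSpace =
        WeakTransport.wassersteinTopology d p := by
  let e := WeakTransport.symVEMetricSpace d hp
  refine ⟨EMetricSpace.toMetricSpace fun P Q => (max_lt (WeakTransport.weakV_lt_top hp P Q)
    (WeakTransport.weakV_lt_top hp Q P)).ne, fun P Q => rfl, ?_⟩
  refine TopologicalSpace.ext_iff.2 fun U => ?_
  refine (EMetric.isOpen_iff (α := WeakTransport.PSpace d p)).trans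
    ⟨fun h P hP => ?_, fun h P hP => ?_⟩
  · obtain ⟨ε, hε, hU⟩ := h P hP
    refine ⟨ε, hε, fun Q hQ => hU ?_⟩
    rw [Metric.mem_eball']
    exact (WeakTransport.symV_le_wasserstein hp P Q).trans_lt hQ
  · obtain ⟨ε, hε, hU⟩ := h P hP
    obtain ⟨δ, hδ, hPQ⟩ := WeakTransport.exists_symV_lt_imp_wasserstein_lt hp P hε
    refine ⟨δ, hδ, fun Q hQ => hU Q (hPQ Q ?_)⟩
    rw [Metric.mem_eball'] at hQ
    exact hQ
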